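/- Let $R$ be a commutative $\mathbb{Q}$-algebra (for instance a field of characteristic $0$), let $m\ge 0$, and let $g_1,\ldots,g_m\in R[[x_1,\ldots,x_m]]$ be formal power series. Then there is exactly one $m$-tuple $f_1,\ldots,f_m\in R[[x_1,\ldots,x_m]]$ with $$f_i=x_i\,g_i(f_1,\ldots,f_m),\qquad 1\le i\le m$$ (each such $f_i$ has zero constant term, so that the substitution makes sense). Put $g_{ij}=\partial g_i/\partial x_j$. Then the determinant of the $m\times m$ matrix with entries $\delta_{ij}-x_i\,g_{ij}(f_1,\ldots,f_m)$ is invertible in $R[[x_1,\ldots,x_m]]$, and for all $n_1,\ldots,n_m,k_1,\ldots,k_m\in\mathbb{Z}_{\ge 0}$ the coefficient of $$\frac{x_1^{n_1}}{n_1!}\cdots\frac{x_m^{n_m}}{n_m!}\quad\text{in}\quad \frac{x_1^{k_1}}{k_1!}\cdots\frac{x_m^{k_m}}{k_m!}\;g_1(x_1,\ldots,x_m)^{n_1}\cdots g_m(x_1,\ldots,x_m)^{n_m}$$ is equal to the coefficient of $$\frac{x_1^{n_1}}{n_1!}\cdots\frac{x_m^{n_m}}{n_m!}\quad\text{in}\quad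 \frac{f_1^{k_1}}{k_1!}\cdots\frac{f_m^{k_m}}{k_m!}\cdot\frac{1}{\det\bigl(\delta_{ij}-x_i\,g_{ij}(f_1,\ldots,f_m)\bigr)}.$$ Here the coefficient of $\frac{x_1^{n_1}}{n_1!}\cdots\frac{x_m^{n_m}}{n_m!}$ in a series $F$ is $n_1!\cdots n_m!$ times the coefficient of $x_1^{n_1}\cdots x_m^{n_m}$ in $F$. -/

import Mathlib

open scoped Nat

namespace LagrangeGood

variable {R : Type*} [CommRing R] {m : ℕ}

/-- The system `f_i = x_i g_i(f_1, …, f_m)`. Each equation forces `f_i` to have zero constant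
term, so a solution can always be substituted into a formal power series. -/
def IsSolution (g f : Fin m → MvPowerSeries (Fin m) R) : Prop :=
  ∀ i, f i = MvPowerSeries.X i * MvPowerSeries.subst f (g i)

theorem IsSolution.hasSubst {g f : Fin m → MvPowerSeries (Fin m) R} (h : IsSolution g f) :
    MvPowerSeries.HasSubst f :=
  MvPowerSeries.hasSubst_of_constantCoeff_zero fun i => by rw [h i]; simp

/-- The matrix with entries `δ_ij - x_i (∂g_i/∂x_j)(f_1, …, f_m)`. -/
noncomputable def jacobian (g f : Fin m → MvPowerSeries (Fin m) R) :
    Matrix (Fin m) (Fin m) (MvPowerSeries (Fin m) R) :=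
  Matrix.of fun i j => (if i = j then 1 else 0) -
    MvPowerSeries.X i * MvPowerSeries.subst f (MvPowerSeries.pderiv R j (g i))

/-- The coefficient of `x_1^{n_1}/n_1! ⋯ x_m^{n_m}/n_m!` in `F`. -/
noncomputable def egfCoeff (n : Fin m →₀ ℕ) (F : MvPowerSeries (Fin m) R) : R :=
  (∏ i, ((n i)! : R)) * MvPowerSeries.coeff n F

/-- The divided monomial `f_1^{k_1}/k_1! ⋯ f_m^{k_m}/k_m!`. -/
noncomputable def dividedMonomial [Algebra ℚ R] (f : Fin m → MvPowerSeries (Fin m) R)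
    (k : Fin m →₀ ℕ) : MvPowerSeries (Fin m) R :=
  ∏ i, ((k i)! : ℚ)⁻¹ • f i ^ k i

end LagrangeGood

open MvPowerSeries
open scoped Matrix

namespace MvPowerSeries

section Semiring

variable {σ R : Type*} [CommSemiring R]

/-! Let `L h` be the series whose coefficient at `n` is that of `h * ∏ i, g i ^ n i`; this is
`lagrangeSum g h`. Shifting exponents gives `L (X i * h) = X i * L (g i * h)`, and this rule
determines `L` from `L 1`. Hence `h ↦ L h / L 1` is multiplicative, and it is substitution of the
series `f i = L (X i) / L 1`, which solve the system. Conversely every solution satisfies `L h =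
subst f h * L 1`, whence uniqueness.

It remains to see that `L 1` is the inverse of the Jacobian determinant
(`det_jacobian_mul_lagrangeSum_one`). The coefficient at `n` of their product is that of a
determinant in powers of the `g i`. For `n ≠ 0`, rescaling its rows turns the entries into `x_j
∂/∂x_j` of `g i ^ n i`. Since `x_j ∂/∂x_j` multiplies the coefficient at `q` by `q j`, the expansion
becomes a sum of scalar determinants, each multiplied by coefficients of the `g i ^ n i`; whenever
those are nonzero, the rows of the scalar matrix are dependent. -/

theorem coeff_X_mul_eq_ite (n : σ →₀ ℕ) (i : σ) (F : MvPowerSeries σ R) :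
    coeff n (X i * F) = if n i = 0 then 0 else coeff (n - Finsupp.single i 1) F := by
  rw [X_def, coeff_monomial_mul, one_mul]
  by_cases h : n i = 0
  · rw [if_neg, if_pos h]
    rw [Finsupp.single_le_iff]
    omega
  · rw [if_pos, if_neg h]
    rw [Finsupp.single_le_iff]
    omega

theorem coeff_X_mul_pderiv (n : σ →₀ ℕ) (i : σ) (F : MvPowerSeries σ R) :
    coeff n (X i * pderiv R i F) = n i * coeff n F := by
  rw [coeff_X_mul_eq_ite]
  split_ifs with h
  · simp [h]
  · have hle : Finsupp.single i 1 ≤ n := by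
      rw [Finsupp.single_le_iff]
      omega
    have hc : ((n i - 1 : ℕ) : R) + 1 = n i := by
      exact_mod_cast congrArg (Nat.cast (R := R)) (Nat.succ_pred_eq_of_ne_zero h)
    rw [coeff_pderiv, tsub_add_cancel_of_le hle, mul_comm, Finsupp.tsub_apply,
      Finsupp.single_eq_same, hc]

/-- A power series is its constant term plus a combination of the variables. -/
theorem exists_eq_C_add_sum_X_mul [Fintype σ] [LinearOrder σ] (F : MvPowerSeries σ R) :
    ∃ ψ : σ → MvPowerSeries σ R, F = C (constantCoeff F) + ∑ i, X i * ψ i := by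
  classical
  -- Each nonconstant monomial is assigned to the least variable dividing it, so it is counted once.
  let ψ : σ → MvPowerSeries σ R := fun i p =>
    if ∀ j < i, p j = 0 then coeff (p + Finsupp.single i 1) F else 0
  have hψ : ∀ i p, coeff p (ψ i) =
      if ∀ j < i, p j = 0 then coeff (p + Finsupp.single i 1) F else 0 := fun _ _ => rfl
  refine ⟨ψ, ?_⟩
  ext n
  rw [map_add, map_sum]
  by_cases hn : n = 0
  · subst hn
    simp
  · have hs : n.support.Nonempty := Finsupp.support_nonempty_iff.mpr hn
    set i₀ := n.support.min' hs
    have h₀ : n i₀ ≠ 0 := Finsupp.mem_support_iff.mp (n.support.min'_mem hs)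
    have hlt : ∀ j < i₀, n j = 0 := fun j hj => by
      by_contra hne
      exact absurd (n.support.min'_le j (Finsupp.mem_support_iff.mpr hne)) (not_le.mpr hj)
    rw [coeff_C_of_ne_zero hn, zero_add, Finset.sum_eq_single i₀]
    · have hle : Finsupp.single i₀ 1 ≤ n := by
        rw [Finsupp.single_le_iff]
        omega
      rw [coeff_X_mul_eq_ite, if_neg h₀, hψ, if_pos,
        tsub_add_cancel_of_le hle]
      intro j hj
      simp [hlt j hj]
    · intro j _ hj
      rw [coeff_X_mul_eq_ite]
      split_ifs with h
      · rfl
      · rw [hψ, if_neg]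
        intro hall
        rcases lt_or_gt_of_ne hj with hlt' | hgt
        · exact h (hlt j hlt')
        · have := hall i₀ hgt
          rw [Finsupp.tsub_apply, Finsupp.single_eq_of_ne (ne_of_lt hgt)] at this
          omega
    · simp

/-- A linear operator that kills `1` and turns multiplication by a variable into multiplication
of some value of the operator by a series without constant term is zero. -/
theorem linearMap_eq_zero_of_X_mul [Fintype σ] [LinearOrder σ]
    (E : MvPowerSeries σ R →ₗ[R] MvPowerSeries σ R) (h1 : E 1 = 0)
    (hX : ∀ i F, ∃ u ψ, constantCoeff u = 0 ∧ E (X i * F) = u * E ψ) : E = 0 := by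
  -- Since `u` has order at least 1, each use of `hX` raises the order of all values of `E` by one.
  have key : ∀ (d : ℕ) (F : MvPowerSeries σ R) (n : σ →₀ ℕ), n.degree < d →
      coeff n (E F) = 0 := by
    intro d
    induction d with
    | zero => intro F n hn; omega
    | succ d ih =>
      intro F n hn
      obtain ⟨ψ, hψ⟩ := exists_eq_C_add_sum_X_mul F
      have hC : E (C (constantCoeff F)) = 0 := by
        have : C (σ := σ) (constantCoeff F) = constantCoeff F • (1 : MvPowerSeries σ R) := by
          rw [smul_eq_C_mul, mul_one]
        rw [this, map_smul, h1, smul_zero]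
      rw [hψ, map_add, hC, zero_add, map_sum, map_sum]
      refine Finset.sum_eq_zero fun i _ => ?_
      obtain ⟨u, χ, hu, hE⟩ := hX i (ψ i)
      rw [hE]
      apply coeff_of_lt_order
      calc (n.degree : ℕ∞) < ((d + 1 : ℕ) : ℕ∞) := by exact_mod_cast hn
        _ = 1 + (d : ℕ∞) := by push_cast; exact add_comm _ _
        _ ≤ u.order + (E χ).order :=
          add_le_add (one_le_order_iff_constCoeff_eq_zero.mpr hu) (nat_le_order (ih χ))
        _ ≤ _ := le_order_mul
  ext F n
  exact key _ F n (Nat.lt_succ_self _)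

end Semiring

section Ring

variable {σ R : Type*} [CommRing R] [Fintype σ] [DecidableEq σ]

/-- Scaling rows or columns of the off-diagonal part by the variables gives the same determinant. -/
theorem det_diagonal_sub_X_mul (a : σ → MvPowerSeries σ R)
    (b : Matrix σ σ (MvPowerSeries σ R)) :
    (Matrix.diagonal a - Matrix.diagonal X * b).det =
      (Matrix.diagonal a - b * Matrix.diagonal X).det := by
  -- The two matrices are conjugate up to `diagonal X`, whose determinant is a nonzerodivisor over
  -- any `R`.
  have h : (Matrix.diagonal a - Matrix.diagonal X * b) * Matrix.diagonal X =
      Matrix.diagonal X * (Matrix.diagonal a - b * Matrix.diagonal X) := by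
    rw [sub_mul, mul_sub, Matrix.diagonal_mul_diagonal, Matrix.diagonal_mul_diagonal, mul_assoc]
    simp only [mul_comm (a _)]
  have hd := congrArg Matrix.det h
  rw [Matrix.det_mul, Matrix.det_mul, mul_comm, Matrix.det_diagonal] at hd
  have hX : ∏ i : σ, (X i : MvPowerSeries σ R) ∈ nonZeroDivisors (MvPowerSeries σ R) :=
    Submonoid.prod_mem _ fun i _ => X_mem_nonzeroDivisors
  exact (mul_cancel_left_mem_nonZeroDivisors hX).mp hd

end Ring

end MvPowerSeries

theorem Matrix.det_eq_zero_of_vecMul_eq_zero {ι R : Type*} [CommRing R] [Fintype ι]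
    [DecidableEq ι] (M : Matrix ι ι R) (v : ι → R) (hv : v ᵥ* M = 0) (i : ι) (hi : v i = 1) :
    M.det = 0 := by
  have h : (v ᵥ* M) ᵥ* M.adjugate = M.det • v := by
    rw [Matrix.vecMul_vecMul, Matrix.mul_adjugate, Matrix.vecMul_smul, Matrix.vecMul_one]
  rw [hv, Matrix.zero_vecMul] at h
  simpa [hi] using (congrFun h i).symm

/-! ### The Lagrange operator, existence and uniqueness of the solution -/

namespace LagrangeGood

variable {R : Type*} [CommRing R] {m : ℕ}

/-- The series `∑ n, xⁿ · [xⁿ] (h · ∏ i, g i ^ n i)`, as a linear function of `h`. -/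
noncomputable def lagrangeSum (g : Fin m → MvPowerSeries (Fin m) R) :
    MvPowerSeries (Fin m) R →ₗ[R] MvPowerSeries (Fin m) R where
  toFun h := fun n => coeff n (h * ∏ i, g i ^ n i)
  map_add' h h' := by
    ext n
    change coeff n ((h + h') * _) = coeff n (h * _) + coeff n (h' * _)
    rw [add_mul, map_add]
  map_smul' r h := by
    ext n
    change coeff n ((r • h) * _) = r • coeff n (h * _)
    rw [smul_mul_assoc, map_smul]

section

variable (g : Fin m → MvPowerSeries (Fin m) R)

theorem coeff_lagrangeSum (h : MvPowerSeries (Fin m) R) (n : Fin m →₀ ℕ) :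
    coeff n (lagrangeSum g h) = coeff n (h * ∏ i, g i ^ n i) :=
  rfl

theorem prod_pow_eq_mul_prod_pow_sub_single {n : Fin m →₀ ℕ} {i : Fin m} (hi : n i ≠ 0) :
    ∏ j, g j ^ n j = g i * ∏ j, g j ^ (n - Finsupp.single i 1 : Fin m →₀ ℕ) j := by
  rw [← Finset.mul_prod_erase _ _ (Finset.mem_univ i), ← Finset.mul_prod_erase Finset.univ
    (fun j => g j ^ (n - Finsupp.single i 1 : Fin m →₀ ℕ) j) (Finset.mem_univ i), ← mul_assoc]
  congr 1
  · rw [Finsupp.tsub_apply, Finsupp.single_eq_same, ← pow_succ', Nat.sub_add_cancel]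
    omega
  · refine Finset.prod_congr rfl fun j hj => ?_
    rw [Finsupp.tsub_apply, Finsupp.single_eq_of_ne (Finset.ne_of_mem_erase hj), Nat.sub_zero]

theorem lagrangeSum_X_mul (i : Fin m) (h : MvPowerSeries (Fin m) R) :
    lagrangeSum g (X i * h) = X i * lagrangeSum g (g i * h) := by
  ext n
  rw [coeff_lagrangeSum, mul_assoc, coeff_X_mul_eq_ite, coeff_X_mul_eq_ite]
  split_ifs with hi
  · rfl
  · rw [coeff_lagrangeSum, prod_pow_eq_mul_prod_pow_sub_single g hi]
    congr 1
    ring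

theorem constantCoeff_lagrangeSum_one : constantCoeff (lagrangeSum g 1) = 1 := by
  rw [← coeff_zero_eq_constantCoeff_apply, coeff_lagrangeSum]
  simp

theorem isUnit_lagrangeSum_one : IsUnit (lagrangeSum g 1) := by
  rw [isUnit_iff_constantCoeff, constantCoeff_lagrangeSum_one]
  exact isUnit_one

/-- Both sides, as functions of `h`, agree at 1 and obey the same rule for multiplication by `X i`.
-/
theorem lagrangeSum_mul (h h' : MvPowerSeries (Fin m) R) :
    lagrangeSum g (h * h') * lagrangeSum g 1 = lagrangeSum g h * lagrangeSum g h' := by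
  let E : MvPowerSeries (Fin m) R →ₗ[R] MvPowerSeries (Fin m) R :=
    LinearMap.mulRight R (lagrangeSum g 1) ∘ₗ lagrangeSum g ∘ₗ LinearMap.mulRight R h' -
      LinearMap.mulRight R (lagrangeSum g h') ∘ₗ lagrangeSum g
  have hE : ∀ F, E F = lagrangeSum g (F * h') * lagrangeSum g 1 -
      lagrangeSum g F * lagrangeSum g h' := fun F => rfl
  have h0 : E = 0 := by
    refine linearMap_eq_zero_of_X_mul E ?_ fun i F => ⟨X i, g i * F, constantCoeff_X i, ?_⟩
    · rw [hE, one_mul]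
      ring
    · rw [hE, hE, mul_assoc (X i), lagrangeSum_X_mul, lagrangeSum_X_mul, mul_assoc (g i)]
      ring
  rw [← sub_eq_zero, ← hE, h0, LinearMap.zero_apply]

end

variable {g f : Fin m → MvPowerSeries (Fin m) R}

/-- The recursion `hX` replaces the assumption that `f` is a solution, so that this also serves to
construct one. -/
theorem lagrangeSum_eq_subst_mul (hf : HasSubst f)
    (hX : ∀ i h, ∃ u h', constantCoeff u = 0 ∧
      lagrangeSum g (X i * h) - subst f (X i * h) * lagrangeSum g 1 =
        u * (lagrangeSum g h' - subst f h' * lagrangeSum g 1))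
    (h : MvPowerSeries (Fin m) R) :
    lagrangeSum g h = subst f h * lagrangeSum g 1 := by
  let E : MvPowerSeries (Fin m) R →ₗ[R] MvPowerSeries (Fin m) R :=
    lagrangeSum g - LinearMap.mulRight R (lagrangeSum g 1) ∘ₗ (substAlgHom hf).toLinearMap
  have hE : ∀ F, E F = lagrangeSum g F - subst f F * lagrangeSum g 1 := fun F => by
    rw [← substAlgHom_apply hf]
    rfl
  have h0 : E = 0 := by
    refine linearMap_eq_zero_of_X_mul E ?_ fun i F => ?_
    · rw [hE, ← substAlgHom_apply hf, map_one (substAlgHom hf), one_mul, sub_self]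
    · simpa only [hE] using hX i F
  rw [← sub_eq_zero, ← hE, h0, LinearMap.zero_apply]

theorem IsSolution.lagrangeSum_eq (hf : IsSolution g f) (h : MvPowerSeries (Fin m) R) :
    lagrangeSum g h = subst f h * lagrangeSum g 1 := by
  refine lagrangeSum_eq_subst_mul hf.hasSubst
    (fun i F => ⟨X i, g i * F, constantCoeff_X i, ?_⟩) h
  rw [lagrangeSum_X_mul, subst_mul hf.hasSubst, subst_mul hf.hasSubst, subst_X hf.hasSubst]
  conv_lhs => rw [hf i]
  ring

theorem IsSolution.subst_mul_lagrangeSum (hf : IsSolution g f) (b h : MvPowerSeries (Fin m) R) :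
    subst f b * lagrangeSum g h = lagrangeSum g (b * h) := by
  rw [hf.lagrangeSum_eq h, hf.lagrangeSum_eq (b * h), subst_mul hf.hasSubst, mul_assoc]

theorem IsSolution.unique {f' : Fin m → MvPowerSeries (Fin m) R} (hf : IsSolution g f)
    (hf' : IsSolution g f') : f = f' := by
  funext i
  have h := (hf.lagrangeSum_eq (X i)).symm.trans (hf'.lagrangeSum_eq (X i))
  rw [subst_X hf.hasSubst, subst_X hf'.hasSubst] at h
  exact (isUnit_lagrangeSum_one g).mul_right_cancel h

variable (g) in
theorem exists_isSolution : ∃ f, IsSolution g f := by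
  obtain ⟨v, hv⟩ := (isUnit_lagrangeSum_one g).exists_right_inv
  let f : Fin m → MvPowerSeries (Fin m) R := fun i => lagrangeSum g (X i) * v
  have hfi : ∀ i, f i = X i * (lagrangeSum g (g i) * v) := fun i => by
    have := lagrangeSum_X_mul g i 1
    rw [mul_one, mul_one] at this
    rw [← mul_assoc, ← this]
  have hc : ∀ i, constantCoeff (f i) = 0 := fun i => by
    rw [hfi]
    simp
  have hf : HasSubst f := hasSubst_of_constantCoeff_zero hc
  have hL : ∀ h, lagrangeSum g h = subst f h * lagrangeSum g 1 := by
    -- That `f` is a solution is not yet known; multiplicativity of `L h / L 1` supplies the factor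
    -- `f i` in place of `X i`.
    refine lagrangeSum_eq_subst_mul hf fun i F => ⟨f i, F, hc i, ?_⟩
    have hm : lagrangeSum g (X i * F) = f i * lagrangeSum g F := by
      calc lagrangeSum g (X i * F) = lagrangeSum g (X i * F) * lagrangeSum g 1 * v := by
            rw [mul_assoc, hv, mul_one]
        _ = f i * lagrangeSum g F := by
            rw [lagrangeSum_mul]
            ring
    rw [hm, subst_mul hf, subst_X hf]
    ring
  refine ⟨f, fun i => ?_⟩
  rw [hfi, hL (g i), mul_assoc, hv, mul_one]

/-! ### The Jacobian determinant -/

/-- Coefficients of products of affine expressions in the variables, in terms of `g`. -/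
theorem IsSolution.coeff_prod_mul_lagrangeSum (hf : IsSolution g f) (a : Fin m → R)
    (b : Fin m → MvPowerSeries (Fin m) R) (s : Finset (Fin m)) (n : Fin m →₀ ℕ)
    (h : MvPowerSeries (Fin m) R) :
    coeff n ((∏ i ∈ s, (C (a i) - X i * subst f (b i))) * lagrangeSum g h) =
      coeff n ((∏ i ∈ s, (C (a i) * g i ^ n i -
        X i * if n i = 0 then 0 else g i ^ (n i - 1) * b i)) *
          ((∏ i ∈ sᶜ, g i ^ n i) * h)) := by
  induction s using Finset.induction_on generalizing n h with
  | empty => rw [Finset.prod_empty, Finset.prod_empty, one_mul, one_mul, coeff_lagrangeSum,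
      Finset.compl_empty, mul_comm h]
  | insert i s his ih =>
    have hcompl : ∀ p : Fin m → MvPowerSeries (Fin m) R,
        ∏ j ∈ sᶜ, p j = p i * ∏ j ∈ (insert i s)ᶜ, p j := fun p => by
      rw [Finset.compl_insert, Finset.mul_prod_erase _ _ (Finset.mem_compl.mpr his)]
    rw [Finset.prod_insert his, Finset.prod_insert his]
    -- `subst f (b i)` is absorbed into the operator as a factor `b i` of its argument.
    have hl : (C (a i) - X i * subst f (b i)) * (∏ j ∈ s, (C (a j) - X j * subst f (b j))) *
        lagrangeSum g h = C (a i) * ((∏ j ∈ s, (C (a j) - X j * subst f (b j))) *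
          lagrangeSum g h) - X i * ((∏ j ∈ s, (C (a j) - X j * subst f (b j))) *
            lagrangeSum g (b i * h)) := by
      rw [← hf.subst_mul_lagrangeSum]
      ring
    set P := ∏ j ∈ s, (C (a j) * g j ^ n j -
      X j * if n j = 0 then 0 else g j ^ (n j - 1) * b j)
    set Q := ∏ j ∈ (insert i s)ᶜ, g j ^ n j
    have hr : ∀ c : MvPowerSeries (Fin m) R, (C (a i) * g i ^ n i - X i * c) * P * (Q * h) =
        C (a i) * (P * (g i ^ n i * Q * h)) - X i * (P * (c * Q * h)) := fun c => by ring
    rw [hl, hr, map_sub, map_sub, coeff_C_mul, coeff_C_mul, ih, hcompl]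
    congr 1
    rw [coeff_X_mul_eq_ite, coeff_X_mul_eq_ite]
    split_ifs with hi
    · rfl
    · rw [ih, hcompl, Finsupp.tsub_apply, Finsupp.single_eq_same]
      -- Multiplication by `X i` lowers the exponent at `i` only, and `i` occurs in neither `P` nor
      -- `Q`.
      have hsub : ∀ j, j ≠ i → (n - Finsupp.single i 1 : Fin m →₀ ℕ) j = n j := fun j hj => by
        rw [Finsupp.tsub_apply, Finsupp.single_eq_of_ne hj, Nat.sub_zero]
      have h1 : ∏ j ∈ (insert i s)ᶜ, g j ^ (n - Finsupp.single i 1 : Fin m →₀ ℕ) j = Q :=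
        Finset.prod_congr rfl fun j hj => by
          rw [hsub j]
          rintro rfl
          simp at hj
      have h2 : ∏ j ∈ s, (C (a j) * g j ^ (n - Finsupp.single i 1 : Fin m →₀ ℕ) j -
          X j * if (n - Finsupp.single i 1 : Fin m →₀ ℕ) j = 0 then 0 else
            g j ^ ((n - Finsupp.single i 1 : Fin m →₀ ℕ) j - 1) * b j) = P :=
        Finset.prod_congr rfl fun j hj => by
          rw [hsub j]
          rintro rfl
          exact his hj
      rw [h1, h2]
      congr 1
      ring

theorem IsSolution.coeff_det_jacobian_mul (hf : IsSolution g f) (n : Fin m →₀ ℕ) :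
    coeff n ((jacobian g f).det * lagrangeSum g 1) =
      coeff n (Matrix.diagonal (fun i => g i ^ n i) - Matrix.diagonal X *
        Matrix.of fun i j => if n i = 0 then 0 else g i ^ (n i - 1) * pderiv R j (g i)).det := by
  -- Transposing makes each term of the expansion a product over rows, matching the factor `X i` of
  -- row `i`.
  rw [← Matrix.det_transpose, Matrix.det_apply, ← Matrix.det_transpose, Matrix.det_apply,
    Finset.sum_mul, map_sum, map_sum]
  refine Finset.sum_congr rfl fun τ _ => ?_
  rw [smul_mul_assoc, Units.smul_def, Units.smul_def, map_zsmul, map_zsmul]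
  congr 1
  have h := hf.coeff_prod_mul_lagrangeSum (fun i => if i = τ i then 1 else 0)
    (fun i => pderiv R (τ i) (g i)) Finset.univ n 1
  rw [Finset.compl_univ, Finset.prod_empty, mul_one, mul_one] at h
  convert h using 2
  · congr 1
    refine Finset.prod_congr rfl fun i _ => ?_
    simp only [Matrix.transpose_apply, jacobian, Matrix.of_apply]
    split_ifs <;> simp
  · refine Finset.prod_congr rfl fun i _ => ?_
    rw [Matrix.transpose_apply, Matrix.sub_apply, Matrix.diagonal_mul, Matrix.of_apply,
      Matrix.diagonal_apply]
    split_ifs <;> simp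

/-- Rows of the determinant rescaled by the (nonzero) exponents are logarithmic derivatives, and
the coefficient at the exponent itself vanishes. -/
theorem coeff_det_diagonal_sub_pderiv_eq_zero (g : Fin m → MvPowerSeries (Fin m) R)
    {n : Fin m →₀ ℕ} (hn : n ≠ 0) :
    coeff n (Matrix.of fun i j => (Matrix.diagonal (fun i => ((if n i = 0 then 1 else n i : ℕ) :
      MvPowerSeries (Fin m) R) * g i ^ n i) i j) - X j * pderiv R j (g i ^ n i)).det = 0 := by
  classical
  set c : Fin m → ℕ := fun i => if n i = 0 then 1 else n i with hc
  let M (p : Fin m →₀ Fin m →₀ ℕ) : Matrix (Fin m) (Fin m) R :=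
    Matrix.of fun i j => Matrix.diagonal (fun i => (c i : R)) i j - (p i j : R)
  have hentry : ∀ (q : Fin m →₀ ℕ) (i j : Fin m),
      coeff q ((Matrix.diagonal (fun i => (c i : MvPowerSeries (Fin m) R) * g i ^ n i) i j) -
        X j * pderiv R j (g i ^ n i)) =
      (Matrix.diagonal (fun i => (c i : R)) i j - (q j : R)) * coeff q (g i ^ n i) := by
    intro q i j
    rw [map_sub, coeff_X_mul_pderiv, sub_mul, Matrix.diagonal_apply, Matrix.diagonal_apply]
    congr 1
    split_ifs
    · rw [← map_natCast (C (σ := Fin m) (R := R)), coeff_C_mul]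
    · simp
  have hexpand : coeff n (Matrix.of fun i j =>
      (Matrix.diagonal (fun i => (c i : MvPowerSeries (Fin m) R) * g i ^ n i) i j) -
        X j * pderiv R j (g i ^ n i)).det =
      ∑ p ∈ Finset.finsuppAntidiag Finset.univ n,
        (M p).det * ∏ i, coeff (p i) (g i ^ n i) := by
    rw [← Matrix.det_transpose, Matrix.det_apply, map_sum]
    simp_rw [← Matrix.det_transpose (M _), Matrix.det_apply, Finset.sum_mul]
    rw [Finset.sum_comm]
    refine Finset.sum_congr rfl fun τ _ => ?_
    rw [Units.smul_def, map_zsmul, coeff_prod, Finset.smul_sum]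
    refine Finset.sum_congr rfl fun p _ => ?_
    rw [smul_mul_assoc, ← Finset.prod_mul_distrib, Units.smul_def]
    congr 1
    refine Finset.prod_congr rfl fun i _ => ?_
    rw [Matrix.transpose_apply, Matrix.of_apply, hentry]
    rfl
  refine hexpand.trans (Finset.sum_eq_zero fun p hp => ?_)
  -- If `n i = 0`, then `g i ^ n i = 1` and only `p i = 0` contributes. The remaining rows then sum
  -- to zero: column `j` gives `n j - ∑ i, p i j = 0`.
  by_cases hT : ∀ i, n i = 0 → p i = 0
  · obtain ⟨i₀, hi₀⟩ := Finsupp.ne_iff.mp hn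
    rw [Finsupp.zero_apply] at hi₀
    rw [Matrix.det_eq_zero_of_vecMul_eq_zero (M p) (fun i => if n i = 0 then 0 else 1) ?_ i₀
      (if_neg hi₀), zero_mul]
    funext j
    have hsum : ∑ i, p i j = n j := by
      rw [← (Finset.mem_finsuppAntidiag.mp hp).1, Finsupp.finsetSum_apply]
    have hterm : ∀ i, (if n i = 0 then (0 : R) else 1) * M p i j =
        (if i = j then (n j : R) else 0) - (p i j : R) := by
      intro i
      by_cases h : n i = 0
      · rw [if_pos h, zero_mul, hT i h]
        by_cases hij : i = j
        · simp [← hij, h]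
        · simp [hij]
      · rw [if_neg h, one_mul]
        simp only [M, Matrix.of_apply, Matrix.diagonal_apply, hc, if_neg h]
        by_cases hij : i = j
        · simp [← hij]
        · simp [hij]
    simp only [Matrix.vecMul_eq_sum, Finset.sum_apply, Pi.smul_apply, smul_eq_mul, hterm]
    rw [Finset.sum_sub_distrib, Finset.sum_ite_eq' Finset.univ j, if_pos (Finset.mem_univ j),
      ← Nat.cast_sum, hsum, sub_self]
    rfl
  · push Not at hT
    obtain ⟨i, hi, hpi⟩ := hT
    rw [Finset.prod_eq_zero (Finset.mem_univ i), mul_zero]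
    rw [hi, pow_zero, coeff_one, if_neg hpi]

theorem IsSolution.det_jacobian_mul_lagrangeSum_one [Algebra ℚ R] (hf : IsSolution g f) :
    (jacobian g f).det * lagrangeSum g 1 = 1 := by
  classical
  ext n
  by_cases hn : n = 0
  · subst hn
    have h0 : (Matrix.of fun _ _ => 0 : Matrix (Fin m) (Fin m) (MvPowerSeries (Fin m) R)) = 0 :=
      rfl
    rw [hf.coeff_det_jacobian_mul]
    simp [h0]
  · rw [hf.coeff_det_jacobian_mul, coeff_one, if_neg hn, det_diagonal_sub_X_mul]
    -- Row `i` is scaled by `n i` to produce the derivative of `g i ^ n i`. Where `n i = 0` the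
    -- factor is 1, so that the product is a unit in a `ℚ`-algebra and can be cancelled.
    set c : Fin m → ℕ := fun i => if n i = 0 then 1 else n i with hc
    have hc0 : ∀ i, c i ≠ 0 := fun i => by
      simp only [hc]
      split_ifs with h <;> omega
    have hu : IsUnit (∏ i, (c i : R)) := by
      rw [← Nat.cast_prod, ← map_natCast (algebraMap ℚ R)]
      refine IsUnit.map _ (IsUnit.mk0 _ ?_)
      exact_mod_cast Finset.prod_ne_zero_iff.mpr fun i _ => hc0 i
    refine hu.mul_left_cancel ?_
    rw [mul_zero, ← coeff_det_diagonal_sub_pderiv_eq_zero g hn, ← coeff_C_mul, map_prod,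
      ← Matrix.det_mul_column]
    congr 2
    ext1 i j
    simp only [Matrix.of_apply, Matrix.sub_apply, Matrix.mul_diagonal, Matrix.diagonal_apply,
      map_natCast, pderiv_pow]
    rw [mul_sub, mul_ite, mul_zero]
    congr 1
    by_cases h : n i = 0
    · simp [h]
    · simp only [hc, if_neg h]
      ring

theorem dividedMonomial_eq_smul [Algebra ℚ R] (f : Fin m → MvPowerSeries (Fin m) R)
    (k : Fin m →₀ ℕ) :
    dividedMonomial f k = algebraMap ℚ R (∏ i, ((k i)! : ℚ)⁻¹) • ∏ i, f i ^ k i := by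
  rw [dividedMonomial, Finset.prod_smul, algebraMap_smul]

end LagrangeGood

theorem theorem1 {R : Type*} [CommRing R] [Algebra ℚ R] (m : ℕ)
    (g : Fin m → MvPowerSeries (Fin m) R) :
    (∃! f : Fin m → MvPowerSeries (Fin m) R, LagrangeGood.IsSolution g f) ∧
    ∀ f : Fin m → MvPowerSeries (Fin m) R, LagrangeGood.IsSolution g f →
      IsUnit (LagrangeGood.jacobian g f).det ∧
      ∀ n k : Fin m →₀ ℕ,
        LagrangeGood.egfCoeff n
            (LagrangeGood.dividedMonomial MvPowerSeries.X k * ∏ i, g i ^ n i) =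
          LagrangeGood.egfCoeff n
            (LagrangeGood.dividedMonomial f k *
              Ring.inverse (LagrangeGood.jacobian g f).det) := by
  obtain ⟨f₀, hf₀⟩ := LagrangeGood.exists_isSolution g
  refine ⟨⟨f₀, hf₀, fun f hf => hf.unique hf₀⟩, fun f hf => ?_⟩
  have hdet := hf.det_jacobian_mul_lagrangeSum_one
  refine ⟨IsUnit.of_mul_eq_one _ hdet, fun n k => ?_⟩
  have hinv : Ring.inverse (LagrangeGood.jacobian g f).det = LagrangeGood.lagrangeSum g 1 := by
    have h := Ring.inverse_mul_cancel_left _ (LagrangeGood.lagrangeSum g 1)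
      (IsUnit.of_mul_eq_one _ hdet)
    rwa [hdet, mul_one] at h
  have hsubst : subst f (∏ i, X i ^ k i : MvPowerSeries (Fin m) R) = ∏ i, f i ^ k i := by
    rw [← substAlgHom_apply hf.hasSubst, map_prod]
    simp_rw [map_pow, substAlgHom_X]
  rw [hinv, LagrangeGood.dividedMonomial_eq_smul, LagrangeGood.dividedMonomial_eq_smul,
    ← hsubst, smul_mul_assoc, smul_mul_assoc, ← hf.lagrangeSum_eq, LagrangeGood.egfCoeff,
    LagrangeGood.egfCoeff, map_smul, map_smul, LagrangeGood.coeff_lagrangeSum]
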